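/- Let $R$ be an associative unital ring with $R\neq 0$ (not necessarily commutative) and let $G$ be a discrete group; modules over the group ring $RG$ are left modules, and $R$ denotes also the trivial $RG$-module. The group $G$ is of type $\mathrm{FP}_2$ over $R$ if $R$ has a resolution by projective $RG$-modules which are finitely generated in degrees $0,1,2$. For an element $x=(x_i)_i$ of a finitely generated free $RG$-module with a fixed free basis, let $|x|=\sum_i|\operatorname{supp}(x_i)|$, where $\operatorname{supp}(x_i)\subseteq G$ is the support of the coordinate $x_i\in RG$. We say that $G$ satisfies a linear $R$-homological isoperimetric inequality in dimension $1$ if there exist a projective resolution $(C_\bullet,\partial_\bullet)$ of the trivial $RG$-module $R$ in which $C_1$ and $C_2$ are finitely generated free $RG$-modules equipped with free bases, and a constant $\kappa\geq 0$, such that for every $\gamma\in\operatorname{im}(\partial_2\colon C_2\to C_1)$ there is $d\in C_2$ with $\partial_2 d=\gamma$ and $|d|\leq\kappa|\gamma|$. Proposition. Let $G$ be a group of type $\mathrm{FP}_2$ over $R$ which satisfies a linear $R$-homological isoperimetric inequality in dimension $1$. Then $G$ is Gromov hyperbolic; that is, $G$ is finitely generated, and for every finite generating set $S$ of $G$ there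 is $\delta\geq 0$ such that in the Cayley graph of $G$ with respect to $S$, with its combinatorial metric, every geodesic triangle is $\delta$-slim (each side lies in the $\delta$-neighbourhood of the union of the other two). -/

import Mathlib

universe u v

noncomputable section

namespace HomologicalFilling

open CategoryTheory

/-! ### Resolutions of the trivial module over a group ring -/

/-- The augmentation `R[G] → R`, `∑ r_g g ↦ ∑ r_g`; the ring `R` need not be commutative. -/
def augmentation (R : Type u) (G : Type v) [Ring R] [Group G] : MonoidAlgebra R G →+* R :=
  MonoidAlgebra.liftNCRingHom (RingHom.id R) (1 : G →* R) (fun x _ => Commute.one_right x)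

/-- The underlying type of the trivial `R[G]`-module `R` (a lifted copy of `R`, in the universe
of `R[G]`). -/
def TrivialModule (R : Type u) (_G : Type v) : Type (max u v) := ULift.{v} R

instance (R : Type u) (G : Type v) [Ring R] : AddCommGroup (TrivialModule R G) :=
  inferInstanceAs (AddCommGroup (ULift.{v} R))

/-- The trivial module `R` as a left `R[G]`-module: `R` acts by left multiplication and every
element of `G` acts as the identity. -/
instance (R : Type u) (G : Type v) [Ring R] [Group G] :
    Module (MonoidAlgebra R G) (TrivialModule R G) :=
  Module.compHom (ULift.{v} R) (augmentation R G)

/-- Projective resolutions of the trivial `R[G]`-module `R` by left `R[G]`-modules. -/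
abbrev Resolution (R : Type u) (G : Type v) [Ring R] [Group G] : Type (max (u + 1) (v + 1)) :=
  ProjectiveResolution (ModuleCat.of (MonoidAlgebra R G) (TrivialModule R G))

/-- `G` is of type `FP_n` over `R`: the trivial `R[G]`-module `R` has a projective resolution
which is finitely generated in all degrees `≤ n`. -/
def IsTypeFP (R : Type u) (G : Type v) [Ring R] [Group G] (n : ℕ) : Prop :=
  ∃ P : Resolution R G, ∀ i ≤ n, Module.Finite (MonoidAlgebra R G) (P.complex.X i)

/-! ### Linear homological isoperimetric inequalities -/

/-- An `n`-admissible structure on a projective resolution: the modules in degrees `n` and `n + 1`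
are finitely generated and free, and they are equipped with free bases. -/
structure Admissible {R : Type u} {G : Type v} [Ring R] [Group G] (C : Resolution R G)
    (n : ℕ) where
  /-- the rank in degree `n` -/
  rank : ℕ
  /-- the rank in degree `n + 1` -/
  rankSucc : ℕ
  /-- the free basis in degree `n` -/
  basis : Module.Basis (Fin rank) (MonoidAlgebra R G) (C.complex.X n)
  /-- the free basis in degree `n + 1` -/
  basisSucc : Module.Basis (Fin rankSucc) (MonoidAlgebra R G) (C.complex.X (n + 1))

/-- `|x|` for an element `x` of a based free `R[G]`-module: the sum, over the coordinates of `x`,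
of the cardinalities of their supports in `G`. -/
def supportNorm {R : Type u} {G : Type v} [Ring R] {r : ℕ} {M : Type*} [Group G] [AddCommGroup M]
    [Module (MonoidAlgebra R G) M] (b : Module.Basis (Fin r) (MonoidAlgebra R G) M) (x : M) : ℕ :=
  ∑ i, (b.repr x i).coeff.support.card

/-- The based resolution `C` satisfies a linear isoperimetric inequality in dimension `n`: there is
`κ ≥ 0` such that every `n`-boundary `γ` is `∂ d` for some `(n+1)`-chain `d` with
`|d| ≤ κ |γ|`. -/
def Admissible.LinearIsoperimetric {R : Type u} {G : Type v} [Ring R] [Group G]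
    {C : Resolution R G} {n : ℕ} (A : Admissible C n) : Prop :=
  ∃ κ : ℝ, 0 ≤ κ ∧ ∀ γ ∈ LinearMap.range (C.complex.d (n + 1) n).hom,
    ∃ d : C.complex.X (n + 1), (C.complex.d (n + 1) n).hom d = γ ∧
      (supportNorm A.basisSucc d : ℝ) ≤ κ * (supportNorm A.basis γ : ℝ)

/-- `G` satisfies a linear `R`-homological isoperimetric inequality in dimension `n`: some
`n`-admissible projective resolution of the trivial `R[G]`-module `R` satisfies one. -/
def SatisfiesLinearIsoperimetric (R : Type u) (G : Type v) [Ring R] [Group G] (n : ℕ) : Prop :=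
  ∃ (C : Resolution R G) (A : Admissible C n), A.LinearIsoperimetric

/-! ### Gromov hyperbolicity -/

/-- A walk of a graph is geodesic if its length is the combinatorial distance of its ends. -/
def IsGeodesic {V : Type*} {Γ : SimpleGraph V} {x y : V} (p : Γ.Walk x y) : Prop :=
  p.length = Γ.dist x y

/-- A graph with its combinatorial metric is Gromov hyperbolic: for some `δ`, all geodesic
triangles are `δ`-slim, that is, every side lies in the `δ`-neighbourhood of the union of the two
others. (It is enough to say this for one side, as the sides can be permuted cyclically. Triangles
have their corners at vertices, which changes only the value of `δ`.) -/
def IsHyperbolicGraph {V : Type*} (Γ : SimpleGraph V) : Prop :=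
  ∃ δ : ℕ, ∀ (x y z : V) (p : Γ.Walk x y) (q : Γ.Walk y z) (r : Γ.Walk z x),
    IsGeodesic p → IsGeodesic q → IsGeodesic r →
      ∀ a ∈ p.support, ∃ b, (b ∈ q.support ∨ b ∈ r.support) ∧ Γ.dist a b ≤ δ

/-- A group is Gromov hyperbolic if it is finitely generated and its Cayley graphs with respect to
finite generating sets are Gromov hyperbolic. -/
def IsHyperbolicGroup (G : Type v) [Group G] : Prop :=
  Group.FG G ∧ ∀ S : Set G, S.Finite → Subgroup.closure S = ⊤ →
    IsHyperbolicGraph (SimpleGraph.mulCayley S)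

end HomologicalFilling

end

/-!
A linear homological isoperimetric inequality makes the Cayley graphs of `G` hyperbolic because
homological fillings satisfy a rectangle inequality, over any nonzero coefficient ring.

*From the resolution to the Cayley graph.* Let `σ` be a finite generating family of `G`. Comparing
the given resolution with the augmented chain complex `R[G]^ι → R[G] → R` of the Cayley graph, by
chain maps in both directions and a homotopy, one gets finitely many cycles `z_k` of the Cayley
graph, to be thought of as the boundaries of 2-cells, such that each cycle `γ` is a sum of at most
`K * |γ|` translates of the `z_k` with coefficients in `R` (`exists_isLinearFilling`). The same
comparison shows that the augmentation ideal is finitely generated, so that `G` is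
(`group_fg_of_resolution`).

*Detours are quadratically long.* Let `a` lie on a geodesic from `x` to `y`, let `w` be a walk from
`y` back to `x` outside the ball of radius `L` about `a`, and let `γ` be the closed walk which they
form. For levels `t` and `j` let `χ` and `ψ` be the indicator functions of `{v | d(a, v) < t}` and
`{v | d(x, v) < j}`, and evaluate the 1-cochain `χ ∪ dψ` on chains (`cupPairing`). If `j` is
slightly larger than `d(x, a)` and `t` is between `L / 2` and `L`, its value on `γ` is `-1`: only
one edge of the geodesic crosses the level `j`, and `χ` vanishes on `w`. On a cycle it vanishes
unless the cycle has vertices on both sides of both levels, and so a translate of `z_k` is detected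
by at most `D ^ 2` pairs `(t, j)`, where `D` bounds the diameters of the `z_k`. Hence
`(L / 2) ^ 2 ≤ D ^ 2 * K * |γ|` (`quadraticDetours_of_isLinearFilling`).

*Detours of linear length.* Take the least `L` such that all triangles of perimeter at most `n` are
`L`-slim, and a point `a` on a side of such a triangle at distance at least `L` from the other two
sides. Leaving the first side at distance `2 * L` on both sides of `a`, one can go around `a` near
the other two sides: either along one of them, or along both up to a place where they have come
close to each other, which the slimness of a smaller triangle provides (`SlimUpTo.exists_detour`).
This detour has length at most `54 * L`, so `L` is bounded independently of `n`
(`QuadraticDetours.isHyperbolicGraph`).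
-/

noncomputable section

namespace HomologicalFilling

open CategoryTheory

/-! ### Slim triangles from long detours -/

section Graph

variable {V : Type*} {Γ : SimpleGraph V}

theorem exists_walk_getVert_getVert {y z : V} (q : Γ.Walk y z) {i j : ℕ} (hij : i ≤ j)
    (hj : j ≤ q.length) :
    ∃ w : Γ.Walk (q.getVert i) (q.getVert j), w.length = j - i ∧ w.support ⊆ q.support := by
  have h : (q.drop i).getVert (j - i) = q.getVert j := by
    rw [SimpleGraph.Walk.drop_getVert, Nat.add_sub_cancel' hij]
  refine ⟨((q.drop i).take (j - i)).copy rfl h, ?_, ?_⟩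
  · rw [SimpleGraph.Walk.length_copy, SimpleGraph.Walk.take_length, SimpleGraph.Walk.drop_length]
    omega
  · intro v hv
    rw [SimpleGraph.Walk.support_copy, SimpleGraph.Walk.mem_support_iff_exists_getVert] at hv
    obtain ⟨m, rfl, -⟩ := hv
    rw [SimpleGraph.Walk.take_getVert, SimpleGraph.Walk.drop_getVert]
    exact q.getVert_mem_support _

theorem IsGeodesic.dist_getVert (hΓ : Γ.Connected) {y z : V} {q : Γ.Walk y z} (hq : IsGeodesic q)
    {i j : ℕ} (hij : i ≤ j) (hj : j ≤ q.length) : Γ.dist (q.getVert i) (q.getVert j) = j - i := by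
  obtain ⟨w, hw, -⟩ := exists_walk_getVert_getVert q hij hj
  have h0 : Γ.dist y (q.getVert i) ≤ i := by
    have := Γ.dist_le (q.take i)
    rw [SimpleGraph.Walk.take_length] at this
    omega
  have h1 : Γ.dist (q.getVert j) z ≤ q.length - j := by
    have := Γ.dist_le (q.drop j)
    rwa [SimpleGraph.Walk.drop_length] at this
  have h2 := Γ.dist_le w
  have h3 := hΓ.dist_triangle (u := y) (v := q.getVert i) (w := z)
  have h4 := hΓ.dist_triangle (u := q.getVert i) (v := q.getVert j) (w := z)
  unfold IsGeodesic at hq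
  omega

theorem IsGeodesic.take (hΓ : Γ.Connected) {y z : V} {q : Γ.Walk y z} (hq : IsGeodesic q)
    {j : ℕ} (hj : j ≤ q.length) : IsGeodesic (q.take j) := by
  have := hq.dist_getVert hΓ (Nat.zero_le j) hj
  rw [SimpleGraph.Walk.getVert_zero] at this
  rw [IsGeodesic, SimpleGraph.Walk.take_length, this]
  omega

theorem IsGeodesic.drop (hΓ : Γ.Connected) {y z : V} {q : Γ.Walk y z} (hq : IsGeodesic q)
    {i : ℕ} (hi : i ≤ q.length) : IsGeodesic (q.drop i) := by
  have := hq.dist_getVert hΓ hi le_rfl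
  rw [SimpleGraph.Walk.getVert_length] at this
  rw [IsGeodesic, SimpleGraph.Walk.drop_length, this]

/-- Any two vertices of a geodesic are joined by a geodesic inside it. -/
theorem IsGeodesic.exists_walk (hΓ : Γ.Connected) {y z : V} {q : Γ.Walk y z} (hq : IsGeodesic q)
    {b c : V} (hb : b ∈ q.support) (hc : c ∈ q.support) :
    ∃ w : Γ.Walk b c, w.length = Γ.dist b c ∧ w.support ⊆ q.support := by
  obtain ⟨i, rfl, hi⟩ := SimpleGraph.Walk.mem_support_iff_exists_getVert.1 hb
  obtain ⟨j, rfl, hj⟩ := SimpleGraph.Walk.mem_support_iff_exists_getVert.1 hc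
  rcases le_total i j with hij | hij
  · obtain ⟨w, hw, hs⟩ := exists_walk_getVert_getVert q hij hj
    exact ⟨w, by rw [hw, hq.dist_getVert hΓ hij hj], hs⟩
  · obtain ⟨w, hw, hs⟩ := exists_walk_getVert_getVert q hij hi
    refine ⟨w.reverse, ?_, ?_⟩
    · rw [SimpleGraph.Walk.length_reverse, hw, SimpleGraph.dist_comm, hq.dist_getVert hΓ hij hi]
    · simpa using hs

theorem dist_le_of_mem_support {b c v : V} (w : Γ.Walk b c) (hv : v ∈ w.support) :
    Γ.dist b v ≤ w.length := by
  classical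
  exact (Γ.dist_le _).trans (w.length_takeUntil_le_length hv)

/-- All geodesic triangles of perimeter at most `n` are `L`-slim. -/
def SlimUpTo (Γ : SimpleGraph V) (n L : ℕ) : Prop :=
  ∀ (x y z : V) (p : Γ.Walk x y) (q : Γ.Walk y z) (r : Γ.Walk z x),
    IsGeodesic p → IsGeodesic q → IsGeodesic r → p.length + q.length + r.length ≤ n →
      ∀ a ∈ p.support, ∃ b, (b ∈ q.support ∨ b ∈ r.support) ∧ Γ.dist a b ≤ L

/-- Points `b` and `c` on two sides of a triangle which are far from `a` can be joined by a
short detour around `a`: follow both sides towards the common corner until they are far from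
`a` but close to each other, and cross over there. -/
theorem SlimUpTo.exists_detour (hΓ : Γ.Connected) {n L : ℕ} (hslim : SlimUpTo Γ n L) (hL : 1 ≤ L)
    {x y z a b c : V} {q : Γ.Walk y z} {r : Γ.Walk z x} (hq : IsGeodesic q) (hr : IsGeodesic r)
    (hn : Γ.dist x y + q.length + r.length ≤ n)
    (hqa : ∀ v ∈ q.support, L ≤ Γ.dist a v) (hra : ∀ v ∈ r.support, L ≤ Γ.dist a v)
    (hb : b ∈ q.support) (hc : c ∈ r.support) (hab : Γ.dist a b ≤ 3 * L)
    (hbc : Γ.dist b c ≤ 6 * L) :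
    ∃ w : Γ.Walk b c, w.length ≤ 48 * L ∧ ∀ v ∈ w.support, L ≤ Γ.dist a v := by
  obtain ⟨i, rfl, hi⟩ := SimpleGraph.Walk.mem_support_iff_exists_getVert.1 hb
  obtain ⟨j, rfl, hj⟩ := SimpleGraph.Walk.mem_support_iff_exists_getVert.1 hc
  have key : ∀ e ∈ q.support, Γ.dist (q.getVert i) e ≤ 20 * L → ∀ f ∈ r.support,
      Γ.dist e f ≤ L → (∀ (s : Γ.Walk e f), s.length = Γ.dist e f → ∀ v ∈ s.support,
        L ≤ Γ.dist a v) →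
      ∃ w : Γ.Walk (q.getVert i) (r.getVert j), w.length ≤ 48 * L ∧
        ∀ v ∈ w.support, L ≤ Γ.dist a v := by
    intro e he hbe f hf hef hs
    obtain ⟨w₁, hw₁, hs₁⟩ := hq.exists_walk hΓ hb he
    obtain ⟨w₂, hw₂⟩ := hΓ.exists_walk_length_eq_dist e f
    obtain ⟨w₃, hw₃, hs₃⟩ := hr.exists_walk hΓ hf hc
    refine ⟨w₁.append (w₂.append w₃), ?_, ?_⟩
    · have h1 := hΓ.dist_triangle (u := f) (v := e) (w := r.getVert j)
      have h2 := hΓ.dist_triangle (u := e) (v := q.getVert i) (w := r.getVert j)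
      rw [SimpleGraph.dist_comm (u := f) (v := e)] at h1
      rw [SimpleGraph.dist_comm (u := e) (v := q.getVert i)] at h2
      simp only [SimpleGraph.Walk.length_append]
      omega
    · intro v hv
      simp only [SimpleGraph.Walk.mem_support_append_iff] at hv
      rcases hv with hv | hv | hv
      · exact hqa v (hs₁ hv)
      · exact hs w₂ hw₂ v hv
      · exact hra v (hs₃ hv)
  -- cross over at the corner `z` if it is near, and otherwise at distance `20 * L` from `b`
  rcases le_or_gt (q.length - i) (20 * L) with hlong | hlong
  · refine key z q.end_mem_support ?_ z r.start_mem_support (by simp) ?_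
    · have := hq.dist_getVert hΓ hi le_rfl
      rw [SimpleGraph.Walk.getVert_length] at this
      omega
    · intro s hs v hv
      have hv' := dist_le_of_mem_support s hv
      rw [hs, SimpleGraph.dist_self, Nat.le_zero, hΓ.dist_eq_zero_iff] at hv'
      exact hv' ▸ hqa z q.end_mem_support
  · have hbe := hq.dist_getVert hΓ (Nat.le_add_right i (20 * L)) (by omega)
    rw [Nat.add_sub_cancel_left] at hbe
    obtain ⟨s, hs⟩ := hΓ.exists_walk_length_eq_dist (r.getVert j) (q.getVert i)
    have he : q.getVert (i + 20 * L) ∈ (q.drop i).support := by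
      rw [← SimpleGraph.Walk.drop_getVert]
      exact SimpleGraph.Walk.getVert_mem_support _ _
    obtain ⟨f, hf, hef⟩ := hslim _ _ _ (q.drop i) (r.take j) s (hq.drop hΓ hi) (hr.take hΓ hj) hs
      (by
        have h1 := hΓ.dist_triangle (u := r.getVert j) (v := x) (w := q.getVert i)
        have h2 := hΓ.dist_triangle (u := x) (v := y) (w := q.getVert i)
        have h3 := hr.dist_getVert hΓ hj le_rfl
        have h4 := hq.dist_getVert hΓ (Nat.zero_le i) hi
        rw [SimpleGraph.Walk.getVert_length] at h3
        rw [SimpleGraph.Walk.getVert_zero] at h4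
        rw [SimpleGraph.Walk.drop_length, SimpleGraph.Walk.take_length, hs]
        omega) _ he
    rcases hf with hf | hf
    · refine key _ (q.getVert_mem_support _) hbe.le f ?_ hef ?_
      · obtain ⟨m, rfl, -⟩ := SimpleGraph.Walk.mem_support_iff_exists_getVert.1 hf
        rw [SimpleGraph.Walk.take_getVert]
        exact r.getVert_mem_support _
      · intro w hw v hv
        have h1 := dist_le_of_mem_support w hv
        have h2 := hΓ.dist_triangle (u := q.getVert i) (v := v) (w := q.getVert (i + 20 * L))
        have h3 := hΓ.dist_triangle (u := q.getVert i) (v := a) (w := v)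
        rw [SimpleGraph.dist_comm (u := q.getVert i) (v := a)] at h3
        rw [SimpleGraph.dist_comm (u := v)] at h2
        omega
    · -- all points of the third side are within `6 * L` of `b`, hence not within `L` of a point
      -- at distance `20 * L` from `b`
      exfalso
      have h1 := dist_le_of_mem_support s hf
      have h1' := dist_le_of_mem_support s.reverse (v := f) (by simpa using hf)
      rw [SimpleGraph.Walk.length_reverse, hs, SimpleGraph.dist_comm (u := r.getVert j)] at h1'
      have h2 := hΓ.dist_triangle (u := q.getVert i) (v := f) (w := q.getVert (i + 20 * L))
      rw [SimpleGraph.dist_comm (u := f)] at h2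
      omega

/-- Detours around a point of a geodesic have at least quadratic length: whenever `a` lies on
a geodesic from `x` to `y`, a walk from `y` to `x` outside the ball of radius `L` about `a`
satisfies `(L / 2) ^ 2 ≤ M * (d(x, y) + length)`. -/
def QuadraticDetours (Γ : SimpleGraph V) (M : ℕ) : Prop :=
  ∀ (x y a : V) (w : Γ.Walk y x) (L : ℕ), Γ.dist x a + Γ.dist a y = Γ.dist x y →
    (∀ v ∈ w.support, L ≤ Γ.dist a v) → (L / 2) ^ 2 ≤ M * (Γ.dist x y + w.length)

/-- If `a` is at distance at least `L` from the other two sides, where `L` is also a slimness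
constant for triangles of this perimeter, then `a` can be bypassed by a detour of length at most
`54 * L`, and the quadratic lower bound for detours bounds `L`. -/
theorem SlimUpTo.le_of_quadraticDetours (hΓ : Γ.Connected) {M : ℕ} (hM : QuadraticDetours Γ M)
    {n L : ℕ} (hslim : SlimUpTo Γ n L) {x y z a : V} {p : Γ.Walk x y} {q : Γ.Walk y z}
    {r : Γ.Walk z x} (hp : IsGeodesic p) (hq : IsGeodesic q) (hr : IsGeodesic r)
    (hn : p.length + q.length + r.length ≤ n) (ha : a ∈ p.support)
    (hfar : ∀ b, b ∈ q.support ∨ b ∈ r.support → L ≤ Γ.dist a b) : L ≤ 324 * M + 1 := by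
  rcases Nat.eq_zero_or_pos L with rfl | hL
  · omega
  obtain ⟨k, rfl, hk⟩ := SimpleGraph.Walk.mem_support_iff_exists_getVert.1 ha
  -- from a point of `p` at distance `2 * L` from `a`, or from an end of `p`, one reaches the other
  -- two sides by a walk of length at most `L` which stays outside the ball about `a`
  have hend : ∀ i ≤ p.length, (Γ.dist (p.getVert k) (p.getVert i) = 2 * L ∨
      Γ.dist (p.getVert k) (p.getVert i) ≤ 2 * L ∧
        (p.getVert i ∈ q.support ∨ p.getVert i ∈ r.support)) →
      ∃ b, (b ∈ q.support ∨ b ∈ r.support) ∧ ∃ s : Γ.Walk (p.getVert i) b, s.length ≤ L ∧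
        ∀ v ∈ s.support, L ≤ Γ.dist (p.getVert k) v := by
    rintro i hi (hd | ⟨-, hb⟩)
    · obtain ⟨b, hb, hib⟩ := hslim x y z p q r hp hq hr hn _ (p.getVert_mem_support i)
      obtain ⟨s, hs⟩ := hΓ.exists_walk_length_eq_dist (p.getVert i) b
      refine ⟨b, hb, s, hs.trans_le hib, fun v hv => ?_⟩
      have h1 := dist_le_of_mem_support s hv
      have h2 := hΓ.dist_triangle (u := p.getVert k) (v := v) (w := p.getVert i)
      rw [SimpleGraph.dist_comm (u := v)] at h2
      omega
    · refine ⟨_, hb, .nil, by simp, fun v hv => ?_⟩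
      rw [SimpleGraph.Walk.mem_support_nil_iff] at hv
      exact hv ▸ hfar _ hb
  obtain ⟨i, hik, hi, hi'⟩ : ∃ i ≤ k, Γ.dist (p.getVert k) (p.getVert i) ≤ 2 * L ∧
      (Γ.dist (p.getVert k) (p.getVert i) = 2 * L ∨
        Γ.dist (p.getVert k) (p.getVert i) ≤ 2 * L ∧
        (p.getVert i ∈ q.support ∨ p.getVert i ∈ r.support)) := by
    have hd := hp.dist_getVert hΓ (Nat.sub_le k (2 * L)) hk
    rw [SimpleGraph.dist_comm] at hd
    refine ⟨k - 2 * L, Nat.sub_le _ _, by omega, ?_⟩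
    rcases le_total (2 * L) k with h | h
    · exact Or.inl (by omega)
    · refine Or.inr ⟨by omega, Or.inr ?_⟩
      rw [Nat.sub_eq_zero_of_le h, SimpleGraph.Walk.getVert_zero]
      exact r.end_mem_support
  obtain ⟨j, hkj, hjl, hj, hj'⟩ : ∃ j, k ≤ j ∧ j ≤ p.length ∧
      Γ.dist (p.getVert k) (p.getVert j) ≤ 2 * L ∧
      (Γ.dist (p.getVert k) (p.getVert j) = 2 * L ∨
        Γ.dist (p.getVert k) (p.getVert j) ≤ 2 * L ∧
        (p.getVert j ∈ q.support ∨ p.getVert j ∈ r.support)) := by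
    have hd := hp.dist_getVert hΓ (j := min (k + 2 * L) p.length)
      (le_min (Nat.le_add_right _ _) hk) (min_le_right _ _)
    refine ⟨min (k + 2 * L) p.length, le_min (Nat.le_add_right _ _) hk, min_le_right _ _,
      by omega, ?_⟩
    rcases le_total (k + 2 * L) p.length with h | h
    · exact Or.inl (by omega)
    · refine Or.inr ⟨by omega, Or.inl ?_⟩
      rw [min_eq_right h, SimpleGraph.Walk.getVert_length]
      exact q.start_mem_support
  obtain ⟨b, hb, s, hs, hsf⟩ := hend i (hik.trans hk) hi'
  obtain ⟨c, hc, t, ht, htf⟩ := hend j hjl hj'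
  have hki := hp.dist_getVert hΓ hik hk
  have hkj' := hp.dist_getVert hΓ hkj hjl
  have hij := hp.dist_getVert hΓ (hik.trans hkj) hjl
  have hij' := SimpleGraph.dist_comm (G := Γ) (u := p.getVert i) (v := p.getVert k)
  have hxy := hp
  unfold IsGeodesic at hxy
  have hib := (Γ.dist_le s).trans hs
  have hjc := (Γ.dist_le t).trans ht
  have hkb : Γ.dist (p.getVert k) b ≤ 3 * L := by
    have := hΓ.dist_triangle (u := p.getVert k) (v := p.getVert i) (w := b)
    omega
  have hkc : Γ.dist (p.getVert k) c ≤ 3 * L := by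
    have := hΓ.dist_triangle (u := p.getVert k) (v := p.getVert j) (w := c)
    omega
  have hcb : Γ.dist c b ≤ 6 * L := by
    have := hΓ.dist_triangle (u := c) (v := p.getVert k) (w := b)
    rw [SimpleGraph.dist_comm (u := c) (v := p.getVert k)] at this
    omega
  have hbc : Γ.dist b c ≤ 6 * L := by rwa [SimpleGraph.dist_comm]
  obtain ⟨w, hw, hwf⟩ : ∃ w : Γ.Walk c b, w.length ≤ 48 * L ∧
      ∀ v ∈ w.support, L ≤ Γ.dist (p.getVert k) v := by
    rcases hb with hb | hb <;> rcases hc with hc | hc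
    · obtain ⟨w, hw, hws⟩ := hq.exists_walk hΓ hc hb
      exact ⟨w, by omega, fun v hv => hfar v (Or.inl (hws hv))⟩
    · obtain ⟨w, hw, hws⟩ := hslim.exists_detour hΓ hL hq hr (hxy ▸ hn)
        (fun v hv => hfar v (Or.inl hv)) (fun v hv => hfar v (Or.inr hv)) hb hc hkb hbc
      exact ⟨w.reverse, by simpa using hw, by simpa using hws⟩
    · exact hslim.exists_detour hΓ hL hq hr (hxy ▸ hn)
        (fun v hv => hfar v (Or.inl hv)) (fun v hv => hfar v (Or.inr hv)) hc hb hkc hcb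
    · obtain ⟨w, hw, hws⟩ := hr.exists_walk hΓ hc hb
      exact ⟨w, by omega, fun v hv => hfar v (Or.inr (hws hv))⟩
  have hquad := hM (p.getVert i) (p.getVert j) (p.getVert k) (t.append (w.append s.reverse)) L
    (by omega) (by
      intro v hv
      simp only [SimpleGraph.Walk.mem_support_append_iff, SimpleGraph.Walk.support_reverse,
        List.mem_reverse] at hv
      rcases hv with hv | hv | hv
      exacts [htf v hv, hwf v hv, hsf v hv])
  simp only [SimpleGraph.Walk.length_append, SimpleGraph.Walk.length_reverse] at hquad
  have hle : (L / 2) ^ 2 ≤ M * (54 * L) :=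
    hquad.trans (Nat.mul_le_mul_left _ (by omega))
  -- for `h = L / 2 ≥ 1` one has `L ≤ 3 * h`, so `h ^ 2 ≤ 162 * M * h`
  rcases Nat.eq_zero_or_pos (L / 2) with h0 | h0
  · omega
  · have h1 : (L / 2) * (L / 2) ≤ (162 * M) * (L / 2) := by
      calc (L / 2) * (L / 2) = (L / 2) ^ 2 := (sq _).symm
        _ ≤ M * (54 * L) := hle
        _ ≤ M * (54 * (3 * (L / 2))) := by gcongr; omega
        _ = (162 * M) * (L / 2) := by ring
    have := Nat.le_of_mul_le_mul_right h1 h0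
    omega

/-- Quadratic lower bounds for detours imply hyperbolicity: for the least `L` such that all
triangles of perimeter at most `n` are `L`-slim, detours of length linear in `L` exist. -/
theorem QuadraticDetours.isHyperbolicGraph (hΓ : Γ.Connected) {M : ℕ}
    (hM : QuadraticDetours Γ M) : IsHyperbolicGraph Γ := by
  classical
  refine ⟨324 * M + 1, fun x y z p q r hp hq hr a ha => ?_⟩
  set n := p.length + q.length + r.length with hn
  have hex : ∃ L, SlimUpTo Γ n L := by
    refine ⟨n, fun x y z p q r _ _ _ hn a ha => ⟨y, Or.inl q.start_mem_support, ?_⟩⟩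
    have := dist_le_of_mem_support p.reverse (v := a) (by simpa using ha)
    rw [SimpleGraph.dist_comm, SimpleGraph.Walk.length_reverse] at this
    omega
  have hle : Nat.find hex ≤ 324 * M + 1 := by
    rcases Nat.eq_zero_or_pos (Nat.find hex) with h0 | h0
    · omega
    have hmin := Nat.find_min hex (Nat.sub_lt h0 one_pos)
    simp only [SlimUpTo] at hmin
    push Not at hmin
    obtain ⟨x, y, z, p, q, r, hp, hq, hr, hn', a, ha, hfar⟩ := hmin
    exact (Nat.find_spec hex).le_of_quadraticDetours hΓ hM hp hq hr hn' ha
      fun b hb => by have := hfar b hb; omega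
  obtain ⟨b, hb, hab⟩ := Nat.find_spec hex x y z p q r hp hq hr hn.ge a ha
  exact ⟨b, hb, hab.trans hle⟩

end Graph

/-! ### Group rings and the augmentation -/

section GroupRing

variable {R : Type u} {G : Type v} [Ring R]

/-- The additive functional `∑ r_g g ↦ ∑ φ(g) r_g` on `R[G]` given by an integer weight `φ`. -/
def weightedSum (φ : G → ℤ) : MonoidAlgebra R G →+ R :=
  (Finsupp.liftAddHom fun g => DistribSMul.toAddMonoidHom R (φ g)).comp
    MonoidAlgebra.coeffAddEquiv.toAddMonoidHom

theorem weightedSum_apply (φ : G → ℤ) (x : MonoidAlgebra R G) :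
    weightedSum φ x = x.coeff.sum fun g r => φ g • r := rfl

@[simp]
theorem weightedSum_single (φ : G → ℤ) (g : G) (r : R) :
    weightedSum φ (MonoidAlgebra.single g r) = φ g • r := by
  simp [weightedSum_apply]

theorem weightedSum_congr {φ ψ : G → ℤ} {x : MonoidAlgebra R G}
    (h : ∀ g ∈ x.coeff.support, φ g = ψ g) : weightedSum φ x = weightedSum ψ x := by
  rw [weightedSum_apply, weightedSum_apply]
  exact Finsupp.sum_congr fun g hg => by rw [h g hg]

theorem weightedSum_zero (x : MonoidAlgebra R G) : weightedSum (fun _ => 0) x = 0 := by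
  simp [weightedSum_apply]

theorem weightedSum_const_mul (n : ℤ) (φ : G → ℤ) (x : MonoidAlgebra R G) :
    weightedSum (fun g => n * φ g) x = n • weightedSum φ x := by
  simp [weightedSum_apply, Finsupp.sum, Finset.mul_sum, mul_assoc]

theorem weightedSum_sub (φ ψ : G → ℤ) (x : MonoidAlgebra R G) :
    weightedSum (fun g => φ g - ψ g) x = weightedSum φ x - weightedSum ψ x := by
  simp [weightedSum_apply, Finsupp.sum, sub_mul]

variable [Group G]

theorem weightedSum_single_mul (φ : G → ℤ) (g : G) (r : R) (x : MonoidAlgebra R G) :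
    weightedSum φ (MonoidAlgebra.single g r * x) = r * weightedSum (fun v => φ (g * v)) x := by
  induction x using MonoidAlgebra.induction_linear with
  | zero => simp
  | add x y hx hy => rw [mul_add, map_add, hx, hy, map_add, mul_add]
  | single v s => rw [MonoidAlgebra.single_mul_single, weightedSum_single, weightedSum_single,
      mul_smul_comm]

theorem weightedSum_mul_single (φ : G → ℤ) (s : G) (x : MonoidAlgebra R G) :
    weightedSum φ (x * MonoidAlgebra.single s 1) = weightedSum (fun v => φ (v * s)) x := by
  induction x using MonoidAlgebra.induction_linear with
  | zero => simp
  | add x y hx hy => rw [add_mul, map_add, hx, hy, map_add]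
  | single v t => simp [MonoidAlgebra.single_mul_single]

theorem augmentation_eq_weightedSum (x : MonoidAlgebra R G) :
    augmentation R G x = weightedSum (fun _ => 1) x := by
  induction x using MonoidAlgebra.induction_linear with
  | zero => simp
  | add x y hx hy => rw [map_add, map_add, hx, hy]
  | single v t => simp [augmentation, MonoidAlgebra.liftNCRingHom]

@[simp]
theorem augmentation_single (g : G) (r : R) :
    augmentation R G (MonoidAlgebra.single g r) = r := by
  simp [augmentation_eq_weightedSum]

/-- The augmentation, as a linear map of `R[G]` onto the trivial module. -/
def augmentationLinear (R : Type u) (G : Type v) [Ring R] [Group G] :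
    MonoidAlgebra R G →ₗ[MonoidAlgebra R G] TrivialModule R G :=
  LinearMap.toSpanSingleton _ _ (ULift.up 1 : ULift.{v} R)

theorem augmentationLinear_apply (x : MonoidAlgebra R G) :
    augmentationLinear R G x = (ULift.up (augmentation R G x) : ULift.{v} R) := by
  change (ULift.up (augmentation R G x * 1) : ULift.{v} R) = _
  rw [mul_one]

theorem augmentationLinear_eq_zero {x : MonoidAlgebra R G} :
    augmentationLinear R G x = 0 ↔ augmentation R G x = 0 := by
  rw [augmentationLinear_apply]
  exact ULift.up_inj (x := augmentation R G x) (y := 0)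

theorem augmentationLinear_surjective : Function.Surjective (augmentationLinear R G) := by
  intro y
  refine ⟨MonoidAlgebra.single 1 (ULift.down y : R), ?_⟩
  rw [augmentationLinear_apply, augmentation_single]
  rfl

/-- If the augmentation ideal is the left ideal generated by a finite set, then `G` is generated
by the supports of the elements of that set: the indicator function of the subgroup `H` which
these generate is a weight whose functional vanishes on the augmentation ideal. -/
theorem group_fg_of_augmentation_ideal_fg [Nontrivial R] (T : Set (MonoidAlgebra R G))
    (hT : T.Finite) (hT₀ : ∀ x ∈ T, augmentation R G x = 0)
    (hspan : ∀ x, augmentation R G x = 0 → x ∈ Submodule.span (MonoidAlgebra R G) T) :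
    Group.FG G := by
  classical
  set U : Set G := ⋃ x ∈ T, (x.coeff.support : Set G) with hU
  refine Group.fg_iff.2 ⟨U, ?_, hT.biUnion fun x _ => x.coeff.support.finite_toSet⟩
  set H := Subgroup.closure U with hH
  have key : ∀ x ∈ Submodule.span (MonoidAlgebra R G) T, ∀ φ : G → ℤ,
      (∀ g, ∀ h ∈ H, φ (g * h) = φ g) → weightedSum φ x = 0 := by
    intro x hx
    induction hx using Submodule.span_induction with
    | mem x hx =>
      intro φ hφ
      have h1 : weightedSum φ x = weightedSum (fun _ => φ 1 * 1) x :=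
        weightedSum_congr fun g hg => by
          have hgH : g ∈ H :=
            Subgroup.subset_closure (Set.mem_biUnion hx (Finset.mem_coe.2 hg))
          rw [mul_one, ← hφ 1 g hgH, one_mul]
      rw [h1, weightedSum_const_mul (φ 1) (fun _ => 1) x, ← augmentation_eq_weightedSum,
        hT₀ x hx, smul_zero]
    | zero => simp
    | add x y _ _ hx hy => intro φ hφ; rw [map_add, hx φ hφ, hy φ hφ, add_zero]
    | smul a x _ hx =>
      intro φ hφ
      rw [smul_eq_mul]
      induction a using MonoidAlgebra.induction_linear with
      | zero => simp
      | add a b ha hb => rw [add_mul, map_add, ha, hb, add_zero]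
      | single g r =>
        rw [weightedSum_single_mul, hx _ fun v h hh => by rw [← mul_assoc, hφ _ h hh], mul_zero]
  rw [eq_top_iff]
  intro g _
  by_contra hg
  have h1 := key (MonoidAlgebra.single g 1 - MonoidAlgebra.single 1 1)
    (hspan _ (by simp)) (fun v => if v ∈ H then 1 else 0)
    (fun v h hh => by simp only [H.mul_mem_cancel_right hh])
  simp [hg, H.one_mem] at h1

end GroupRing

/-! ### Sizes of chains -/

section Size

variable {R : Type u} {G : Type v} [Ring R] {ι κ : Type*} [Fintype ι] [Fintype κ]

theorem card_support_add_le (x y : MonoidAlgebra R G) :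
    (x + y).coeff.support.card ≤ x.coeff.support.card + y.coeff.support.card := by
  classical
  exact (Finset.card_le_card Finsupp.support_add).trans (Finset.card_union_le _ _)

theorem card_support_sum_le {α : Type*} (s : Finset α) (x : α → MonoidAlgebra R G) :
    (∑ i ∈ s, x i).coeff.support.card ≤ ∑ i ∈ s, (x i).coeff.support.card :=
  Finset.le_sum_of_subadditive (fun x : MonoidAlgebra R G => x.coeff.support.card) (by simp)
    card_support_add_le s x

theorem card_support_single_le (g : G) (r : R) :
    (MonoidAlgebra.single g r).coeff.support.card ≤ 1 := by
  classical
  exact (Finset.card_le_card Finsupp.support_single_subset).trans (by simp)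

/-- The size of a vector over `R[G]`: the number of pairs `(i, g)` such that `g` lies in the
support of its `i`-th coordinate. -/
def size (x : ι → MonoidAlgebra R G) : ℕ :=
  ∑ i, (x i).coeff.support.card

theorem size_sum_le {α : Type*} (s : Finset α) (x : α → ι → MonoidAlgebra R G) :
    size (∑ a ∈ s, x a) ≤ ∑ a ∈ s, size (x a) := by
  unfold size
  rw [Finset.sum_comm]
  refine Finset.sum_le_sum fun i _ => ?_
  rw [Finset.sum_apply]
  exact card_support_sum_le s fun a => x a i

theorem size_single [DecidableEq ι] (i : ι) (a : MonoidAlgebra R G) :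
    size (Pi.single i a : ι → MonoidAlgebra R G) = a.coeff.support.card := by
  unfold size
  rw [Finset.sum_eq_single i]
  · rw [Pi.single_eq_same]
  · intro j _ hj
    rw [Pi.single_eq_of_ne hj]
    simp
  · simp

theorem size_sumElim (x : ι → MonoidAlgebra R G) (y : κ → MonoidAlgebra R G) :
    size (Sum.elim x y) = size x + size y := by
  simp [size]

variable [Group G]

theorem card_support_mul_le (x y : MonoidAlgebra R G) :
    (x * y).coeff.support.card ≤ x.coeff.support.card * y.coeff.support.card := by
  classical
  exact (Finset.card_le_card (MonoidAlgebra.support_coeff_mul_subset x y)).trans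
    Finset.card_mul_le

theorem size_smul_le (a : MonoidAlgebra R G) (x : ι → MonoidAlgebra R G) :
    size (a • x) ≤ a.coeff.support.card * size x := by
  unfold size
  rw [Finset.mul_sum]
  exact Finset.sum_le_sum fun i _ => card_support_mul_le a (x i)

/-- Linear maps between based free modules are bounded with respect to the size. -/
theorem exists_size_map_le
    (F : (ι → MonoidAlgebra R G) →ₗ[MonoidAlgebra R G] κ → MonoidAlgebra R G) :
    ∃ K : ℕ, ∀ x, size (F x) ≤ K * size x := by
  classical
  refine ⟨∑ i, size (F (Pi.single i 1)), fun x => ?_⟩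
  have hx : F x = ∑ i, x i • F (Pi.single i 1) := by
    conv_lhs => rw [pi_eq_sum_univ' x]
    rw [map_sum]
    refine Finset.sum_congr rfl fun i _ => ?_
    rw [map_smul]
  calc size (F x) ≤ ∑ i, size (x i • F (Pi.single i 1)) := hx ▸ size_sum_le _ _
    _ ≤ ∑ i, (x i).coeff.support.card * size (F (Pi.single i 1)) :=
        Finset.sum_le_sum fun i _ => size_smul_le _ _
    _ ≤ ∑ i, size x * size (F (Pi.single i 1)) := by
        refine Finset.sum_le_sum fun i _ => Nat.mul_le_mul_right _ ?_
        exact Finset.single_le_sum (f := fun i => (x i).coeff.support.card)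
          (fun _ _ => Nat.zero_le _) (Finset.mem_univ i)
    _ = _ := by rw [← Finset.mul_sum, mul_comm]

end Size

/-! ### The chain complex of a Cayley graph -/

section Cayley

variable {R : Type u} {G : Type v} [Ring R] [Group G] {ι : Type*} [Fintype ι]

/-- The boundary map `∑ x_i e_i ↦ ∑ x_i (σ_i - 1)` of the Cayley graph of `G` with respect to the
family `σ`: the basis element `e_i` is the edge from `1` to `σ_i`. -/
def cayleyBoundary (R : Type u) [Ring R] (σ : ι → G) :
    (ι → MonoidAlgebra R G) →ₗ[MonoidAlgebra R G] MonoidAlgebra R G :=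
  Fintype.linearCombination _ fun i => MonoidAlgebra.single (σ i) 1 - 1

theorem cayleyBoundary_apply (σ : ι → G) (x : ι → MonoidAlgebra R G) :
    cayleyBoundary R σ x = ∑ i, x i * (MonoidAlgebra.single (σ i) 1 - 1) := rfl

theorem cayleyBoundary_single [DecidableEq ι] (σ : ι → G) (i : ι) (a : MonoidAlgebra R G) :
    cayleyBoundary R σ (Pi.single i a) = a * (MonoidAlgebra.single (σ i) 1 - 1) := by
  rw [cayleyBoundary, Fintype.linearCombination_apply_single, smul_eq_mul]

theorem exists_cayleyBoundary_eq (σ : ι → G) (hσ : Subgroup.closure (Set.range σ) = ⊤)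
    {x : MonoidAlgebra R G} (hx : augmentation R G x = 0) : ∃ y, cayleyBoundary R σ y = x := by
  classical
  set N := LinearMap.range (cayleyBoundary R σ) with hN
  have hg : ∀ g : G, (MonoidAlgebra.single g 1 - 1 : MonoidAlgebra R G) ∈ N := by
    intro g
    have hgt : g ∈ Subgroup.closure (Set.range σ) := hσ ▸ Subgroup.mem_top g
    induction hgt using Subgroup.closure_induction with
    | mem g hg =>
      obtain ⟨i, rfl⟩ := hg
      exact ⟨Pi.single i 1, by rw [cayleyBoundary_single, one_mul]⟩
    | one => simp [MonoidAlgebra.one_def]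
    | mul g h _ _ ihg ihh =>
      have := N.add_mem ihg (N.smul_mem (MonoidAlgebra.single g 1) ihh)
      rw [smul_eq_mul, mul_sub, MonoidAlgebra.single_mul_single, mul_one, mul_one] at this
      convert this using 1
      abel
    | inv g _ ihg =>
      have := N.smul_mem (-MonoidAlgebra.single g⁻¹ 1) ihg
      rw [smul_eq_mul, mul_sub, neg_mul, MonoidAlgebra.single_mul_single, mul_one, mul_one,
        inv_mul_cancel, ← MonoidAlgebra.one_def] at this
      convert this using 1
      abel
  have hmem : ∀ x : MonoidAlgebra R G, x - MonoidAlgebra.single 1 (augmentation R G x) ∈ N := by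
    intro x
    induction x using MonoidAlgebra.induction_linear with
    | zero => simp
    | add x y hx hy =>
      convert N.add_mem hx hy using 1
      rw [map_add, MonoidAlgebra.single_add]
      abel
    | single g r =>
      rw [augmentation_single]
      have := N.smul_mem (MonoidAlgebra.single 1 r) (hg g)
      rwa [smul_eq_mul, mul_sub, MonoidAlgebra.single_mul_single, mul_one, one_mul, mul_one] at this
  have := hmem x
  rwa [hx, MonoidAlgebra.single_zero, sub_zero] at this

end Cayley

/-! ### Linear fillings of the cycles of a Cayley graph -/

section Resolution

variable {R : Type u} {G : Type v} [Ring R] [Group G]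

theorem Resolution.exact_succ (C : Resolution R G) (n : ℕ) :
    Function.Exact (C.complex.d (n + 2) (n + 1)).hom (C.complex.d (n + 1) n).hom :=
  (ShortComplex.ShortExact.moduleCat_exact_iff_function_exact _).1
    (ProjectiveResolution.exact_succ C n)

theorem Resolution.exists_augmentation (C : Resolution R G) :
    ∃ ε : C.complex.X 0 →ₗ[MonoidAlgebra R G] TrivialModule R G,
      Function.Surjective ε ∧ Function.Exact (C.complex.d 1 0).hom ε := by
  refine ⟨(C.π.f 0).hom, ?_, ?_⟩
  · exact (ModuleCat.epi_iff_surjective (C.π.f 0)).1 inferInstance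
  · exact (ShortComplex.ShortExact.moduleCat_exact_iff_function_exact _).1
      (ShortComplex.exact_of_g_is_cokernel (ShortComplex.mk _ _ C.complex_d_comp_π_f_zero)
        C.isColimitCokernelCofork)

/-- The part of a resolution in degrees at most one, with its augmentation, compared with the
group ring: a linear map `g₀` over the trivial module, and a lift `c₀` of the generator. -/
theorem Resolution.exists_comparison (C : Resolution R G) :
    ∃ (g₀ : C.complex.X 0 →ₗ[MonoidAlgebra R G] MonoidAlgebra R G) (c₀ : C.complex.X 0),
      augmentation R G (g₀ c₀) = 1 ∧
      (∀ y, augmentation R G (g₀ ((C.complex.d 1 0).hom y)) = 0) ∧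
      ∀ x, augmentation R G x = 0 → ∃ y, (C.complex.d 1 0).hom y = x • c₀ := by
  obtain ⟨ε, hε, hex⟩ := C.exists_augmentation
  have : Module.Projective (MonoidAlgebra R G) (C.complex.X 0) :=
    (IsProjective.iff_projective _).2 (C.projective 0)
  obtain ⟨g₀, hg₀⟩ := Module.projective_lifting_property (augmentationLinear R G) ε
    augmentationLinear_surjective
  obtain ⟨c₀, hc₀⟩ := hε (augmentationLinear R G 1)
  have hg₀' (y) : augmentationLinear R G (g₀ y) = ε y := LinearMap.congr_fun hg₀ y
  refine ⟨g₀, c₀, ?_, fun y => ?_, fun x hx => ?_⟩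
  · have := hg₀' c₀
    rw [hc₀, ← sub_eq_zero, ← map_sub, augmentationLinear_eq_zero, map_sub, map_one,
      sub_eq_zero] at this
    exact this
  · rw [← augmentationLinear_eq_zero, hg₀']
    exact hex.apply_apply_eq_zero y
  · refine (hex (x • c₀)).1 ?_
    rw [map_smul, hc₀, ← map_smul, smul_eq_mul, mul_one]
    exact augmentationLinear_eq_zero.2 hx

theorem group_fg_of_resolution [Nontrivial R] (C : Resolution R G) {n : ℕ}
    (b : Module.Basis (Fin n) (MonoidAlgebra R G) (C.complex.X 1)) : Group.FG G := by
  obtain ⟨g₀, c₀, hc₀, hd, hlift⟩ := C.exists_comparison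
  refine group_fg_of_augmentation_ideal_fg (R := R)
    (insert (1 - g₀ c₀) (Set.range fun i => g₀ ((C.complex.d 1 0).hom (b i))))
    ((Set.finite_range _).insert _) ?_ fun x hx => ?_
  · rintro _ (rfl | ⟨i, rfl⟩)
    · rw [map_sub, hc₀, map_one, sub_self]
    · exact hd _
  · obtain ⟨y, hy⟩ := hlift x hx
    have h1 : x * g₀ c₀ = ∑ i, b.repr y i • g₀ ((C.complex.d 1 0).hom (b i)) := by
      rw [← smul_eq_mul, ← map_smul, ← hy]
      conv_lhs => rw [← b.sum_repr y]
      simp only [map_sum, map_smul]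
    have h2 : x = x • (1 - g₀ c₀) + ∑ i, b.repr y i • g₀ ((C.complex.d 1 0).hom (b i)) := by
      rw [← h1, smul_eq_mul, mul_sub, mul_one, sub_add_cancel]
    rw [h2]
    exact Submodule.add_mem _
      (Submodule.smul_mem _ _ (Submodule.subset_span (Set.mem_insert _ _)))
      (Submodule.sum_mem _ fun i _ => Submodule.smul_mem _ _
        (Submodule.subset_span (Set.mem_insert_of_mem _ ⟨i, rfl⟩)))

/-- A linear filling of the cycles of the Cayley graph of `σ`: the cycles `z k`, finitely many up
to translation, are the cells, and every cycle `γ` bounds at most `K * |γ|` of their translates,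
taken with coefficients in `R`. -/
structure IsLinearFilling {ι κ : Type*} [Fintype ι] [Fintype κ] (σ : ι → G)
    (z : κ → ι → MonoidAlgebra R G) (K : ℕ) : Prop where
  boundary_eq_zero : ∀ k, cayleyBoundary R σ (z k) = 0
  exists_filling : ∀ γ, cayleyBoundary R σ γ = 0 →
    ∃ d : κ → MonoidAlgebra R G, γ = ∑ k, d k • z k ∧ size d ≤ K * size γ

/-- A linear isoperimetric inequality for some resolution gives one for the Cayley graph. With
chain maps `f₁`, `g₁` between the two and a homotopy given by `h`, a cycle `γ` is the sum of
`γ - g₁ (f₁ γ)`, a combination of the cycles `e_i - g₁ (f₁ e_i) + (σ_i - 1) h` with the same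
coefficients as `γ`, and of the image under `g₁` of a filling of `f₁ γ`. -/
theorem exists_isLinearFilling {C : Resolution R G} {A : Admissible C 1}
    (hA : A.LinearIsoperimetric) {ι : Type*} [Fintype ι] (σ : ι → G)
    (hσ : Subgroup.closure (Set.range σ) = ⊤) :
    ∃ (z : ι ⊕ Fin A.rankSucc → ι → MonoidAlgebra R G) (K : ℕ), IsLinearFilling σ z K := by
  classical
  obtain ⟨g₀, c₀, hc₀, hd, hlift⟩ := C.exists_comparison
  obtain ⟨c, hc, hfill⟩ := hA
  set d₁ := (C.complex.d 1 0).hom with hd₁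
  set d₂ := (C.complex.d 2 1).hom with hd₂
  have hex : Function.Exact d₂ d₁ := C.exact_succ 0
  have hu (i : ι) : ∃ y, d₁ y = (MonoidAlgebra.single (σ i) 1 - 1 : MonoidAlgebra R G) • c₀ :=
    hlift _ (by rw [map_sub, augmentation_single, map_one, sub_self])
  choose u hu using hu
  set f₁ : (ι → MonoidAlgebra R G) →ₗ[MonoidAlgebra R G] C.complex.X 1 :=
    Fintype.linearCombination _ u with hf₁
  have hf₁' (x) : d₁ (f₁ x) = cayleyBoundary R σ x • c₀ := by
    simp only [hf₁, Fintype.linearCombination_apply, map_sum, map_smul, hu,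
      cayleyBoundary_apply, Finset.sum_smul, smul_smul]
  have hv (j : Fin A.rank) : ∃ y, cayleyBoundary R σ y = g₀ (d₁ (A.basis j)) :=
    exists_cayleyBoundary_eq σ hσ (hd _)
  choose v hv using hv
  set g₁ : C.complex.X 1 →ₗ[MonoidAlgebra R G] ι → MonoidAlgebra R G :=
    A.basis.constr ℕ v with hg₁
  have hg₁' (y) : cayleyBoundary R σ (g₁ y) = g₀ (d₁ y) := by
    have : (cayleyBoundary R σ).comp g₁ = g₀.comp d₁ :=
      A.basis.ext fun j => by simp [hg₁, hv]
    exact LinearMap.congr_fun this y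
  obtain ⟨h, hh⟩ := exists_cayleyBoundary_eq (R := R) σ hσ (x := g₀ c₀ - 1)
    (by rw [map_sub, hc₀, map_one, sub_self])
  obtain ⟨K, hK⟩ := exists_size_map_le (A.basis.equivFun.toLinearMap.comp f₁)
  refine ⟨Sum.elim (fun i => Pi.single i 1 - g₁ (u i) +
      (MonoidAlgebra.single (σ i) 1 - 1 : MonoidAlgebra R G) • h)
    (fun k => g₁ (d₂ (A.basisSucc k))), 1 + ⌈c⌉₊ * K, ?_, ?_⟩
  · rintro (i | k)
    · rw [Sum.elim_inl, map_add, map_sub, map_smul, hh, hg₁', hu, map_smul,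
        cayleyBoundary_single, smul_eq_mul, smul_eq_mul, one_mul, mul_sub, mul_one]
      abel
    · rw [Sum.elim_inr, hg₁', hex.apply_apply_eq_zero, map_zero]
  · intro γ hγ
    obtain ⟨y, hy, hle⟩ := hfill (f₁ γ)
      ((hex _).1 (by rw [hf₁', hγ, zero_smul]))
    refine ⟨Sum.elim γ (A.basisSucc.repr y), ?_, ?_⟩
    · have h1 : ∑ i, γ i • (Pi.single i 1 : ι → MonoidAlgebra R G) = γ :=
        (pi_eq_sum_univ' γ).symm
      have h2 : ∑ i, γ i • g₁ (u i) = g₁ (f₁ γ) := by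
        simp only [hf₁, Fintype.linearCombination_apply, map_sum, map_smul]
      have h3 : ∑ i, γ i • (MonoidAlgebra.single (σ i) 1 - 1 : MonoidAlgebra R G) • h = 0 := by
        simp only [smul_smul, ← Finset.sum_smul]
        rw [← cayleyBoundary_apply, hγ, zero_smul]
      have h4 : ∑ k, A.basisSucc.repr y k • g₁ (d₂ (A.basisSucc k)) = g₁ (f₁ γ) := by
        rw [← hy]
        conv_rhs => rw [← A.basisSucc.sum_repr y]
        simp only [map_sum, map_smul]
      simp only [Fintype.sum_sum_type, Sum.elim_inl, Sum.elim_inr, smul_add, smul_sub,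
        Finset.sum_add_distrib, Finset.sum_sub_distrib, h1, h2, h3, h4]
      abel
    · rw [size_sumElim, add_mul, one_mul]
      refine Nat.add_le_add_left ?_ _
      have h1 : supportNorm A.basis (f₁ γ) ≤ K * size γ := hK γ
      have h2 : (supportNorm A.basisSucc y : ℝ) ≤ ((⌈c⌉₊ * K * size γ : ℕ) : ℝ) := by
        refine hle.trans ?_
        rw [mul_assoc, Nat.cast_mul]
        exact mul_le_mul (Nat.le_ceil c) (Nat.cast_le.2 h1) (Nat.cast_nonneg _)
          (Nat.cast_nonneg _)
      exact Nat.cast_le.1 h2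

end Resolution

/-! ### The metric of a Cayley graph -/

section CayleyGraph

variable {G : Type v} [Group G]

theorem mulCayley_connected {S : Set G} (hS : Subgroup.closure S = ⊤) :
    (SimpleGraph.mulCayley S).Connected := by
  have hmul : ∀ g ∈ Subgroup.closure S, ∀ u, (SimpleGraph.mulCayley S).Reachable u (u * g) := by
    intro g hg
    induction hg using Subgroup.closure_induction with
    | mem s hs =>
      intro u
      by_cases hu : u = u * s
      · rw [← hu]
      · exact SimpleGraph.Adj.reachable
          ((SimpleGraph.mulCayley_adj' S _ _).2 ⟨hu, s, hs, Or.inl rfl⟩)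
    | one => intro u; rw [mul_one]
    | mul g h _ _ ihg ihh =>
      intro u
      rw [← mul_assoc]
      exact (ihg u).trans (ihh _)
    | inv g _ ihg =>
      intro u
      simpa using (ihg (u * g⁻¹)).symm
  have : Nonempty G := ⟨1⟩
  refine ⟨fun u v => ?_⟩
  simpa using hmul (u⁻¹ * v) (hS ▸ Subgroup.mem_top _) u

theorem dist_mulCayley_mul_left_le {S : Set G} (hS : Subgroup.closure S = ⊤) (g u v : G) :
    (SimpleGraph.mulCayley S).dist (g * u) (g * v) ≤ (SimpleGraph.mulCayley S).dist u v := by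
  obtain ⟨w, hw⟩ := (mulCayley_connected hS).exists_walk_length_eq_dist u v
  have := (SimpleGraph.mulCayley S).dist_le (w.map
    (⟨fun x => g * x, SimpleGraph.mulCayley_adj_mul_iff_right.2⟩ :
      SimpleGraph.mulCayley S →g SimpleGraph.mulCayley S))
  rwa [SimpleGraph.Walk.length_map, hw] at this

end CayleyGraph

/-! ### Cup products of sublevel functions and the length of detours -/

/-- The indicator function of the sublevel set `{v | f v < t}`. -/
def sublevel {V : Type*} (f : V → ℕ) (t : ℕ) (v : V) : ℤ := if f v < t then 1 else 0

theorem sublevel_of_lt {V : Type*} {f : V → ℕ} {t : ℕ} {v : V} (h : f v < t) : sublevel f t v = 1 := if_pos h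

theorem sublevel_of_le {V : Type*} {f : V → ℕ} {t : ℕ} {v : V} (h : t ≤ f v) : sublevel f t v = 0 :=
  if_neg h.not_gt

section Pairing

variable {R : Type u} {G : Type v} [Ring R] [Group G] {ι κ : Type*}

/-- The vertices of the edges `(g, i)`, from `g` to `g * σ i`, in the support of a chain. -/
def chainVertices (σ : ι → G) (x : ι → MonoidAlgebra R G) : Set G :=
  ⋃ i, ((x i).coeff.support ∪ (fun g => g * σ i) '' (x i).coeff.support)

theorem mem_chainVertices_left {σ : ι → G} {x : ι → MonoidAlgebra R G} {i : ι} {g : G}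
    (hg : g ∈ (x i).coeff.support) : g ∈ chainVertices σ x :=
  Set.mem_iUnion.2 ⟨i, Or.inl hg⟩

theorem mem_chainVertices_right {σ : ι → G} {x : ι → MonoidAlgebra R G} {i : ι} {g : G}
    (hg : g ∈ (x i).coeff.support) : g * σ i ∈ chainVertices σ x :=
  Set.mem_iUnion.2 ⟨i, Or.inr ⟨g, hg, rfl⟩⟩

variable [Fintype ι] [Fintype κ]

theorem finite_chainVertices (σ : ι → G) (x : ι → MonoidAlgebra R G) :
    (chainVertices σ x).Finite :=
  Set.finite_iUnion fun _ => (Finset.finite_toSet _).union ((Finset.finite_toSet _).image _)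

/-- The cup product `χ ∪ dψ` of a function `χ` on the vertices of the Cayley graph with the
coboundary of a function `ψ`, evaluated on chains. -/
def cupPairing (σ : ι → G) (χ ψ : G → ℤ) : (ι → MonoidAlgebra R G) →+ R :=
  ∑ i, (weightedSum fun v => χ v * (ψ (v * σ i) - ψ v)).comp (Pi.evalAddMonoidHom _ i)

theorem cupPairing_apply (σ : ι → G) (χ ψ : G → ℤ) (x : ι → MonoidAlgebra R G) :
    cupPairing σ χ ψ x = ∑ i, weightedSum (fun v => χ v * (ψ (v * σ i) - ψ v)) (x i) := by
  simp [cupPairing]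

theorem cupPairing_single_smul (σ : ι → G) (χ ψ : G → ℤ) (g : G) (r : R)
    (x : ι → MonoidAlgebra R G) :
    cupPairing σ χ ψ ((MonoidAlgebra.single g r : MonoidAlgebra R G) • x) =
      r * cupPairing σ (fun v => χ (g * v)) (fun v => ψ (g * v)) x := by
  simp only [cupPairing_apply, Pi.smul_apply, smul_eq_mul, weightedSum_single_mul,
    Finset.mul_sum, mul_assoc]

theorem cupPairing_eq_zero_of_left {σ : ι → G} {χ ψ : G → ℤ} {x : ι → MonoidAlgebra R G}
    (h : ∀ v ∈ chainVertices σ x, χ v = 0) : cupPairing σ χ ψ x = 0 := by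
  rw [cupPairing_apply]
  refine Finset.sum_eq_zero fun i _ => ?_
  rw [weightedSum_congr (ψ := fun _ => 0), weightedSum_zero]
  intro g hg
  rw [h g (mem_chainVertices_left hg), zero_mul]

theorem cupPairing_eq_zero_of_right {σ : ι → G} {χ ψ : G → ℤ} {x : ι → MonoidAlgebra R G}
    {n : ℤ} (h : ∀ v ∈ chainVertices σ x, ψ v = n) : cupPairing σ χ ψ x = 0 := by
  rw [cupPairing_apply]
  refine Finset.sum_eq_zero fun i _ => ?_
  rw [weightedSum_congr (ψ := fun _ => 0), weightedSum_zero]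
  intro g hg
  rw [h g (mem_chainVertices_left hg), h _ (mem_chainVertices_right hg), sub_self, mul_zero]

/-- Where `χ = 1`, the pairing is the evaluation of `dψ`, which depends on the boundary only. -/
theorem cupPairing_eq_weightedSum_boundary {σ : ι → G} {χ ψ : G → ℤ}
    {x : ι → MonoidAlgebra R G} (h : ∀ v ∈ chainVertices σ x, χ v = 1) :
    cupPairing σ χ ψ x = weightedSum ψ (cayleyBoundary R σ x) := by
  rw [cupPairing_apply, cayleyBoundary_apply, map_sum]
  refine Finset.sum_congr rfl fun i _ => ?_
  rw [mul_sub, mul_one, map_sub, weightedSum_mul_single, ← weightedSum_sub]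
  refine weightedSum_congr fun g hg => ?_
  rw [h g (mem_chainVertices_left hg), one_mul]

/-- A cycle which is detected by two sublevel sets has vertices on both sides of each of them. -/
theorem exists_crossing_of_cupPairing_ne_zero {σ : ι → G} {f₁ f₂ : G → ℕ} {t₁ t₂ : ℕ}
    {x : ι → MonoidAlgebra R G} (hx : cayleyBoundary R σ x = 0)
    (h : cupPairing σ (sublevel f₁ t₁) (sublevel f₂ t₂) x ≠ 0) :
    ((∃ v ∈ chainVertices σ x, f₁ v < t₁) ∧ ∃ v ∈ chainVertices σ x, t₁ ≤ f₁ v) ∧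
      (∃ v ∈ chainVertices σ x, f₂ v < t₂) ∧ ∃ v ∈ chainVertices σ x, t₂ ≤ f₂ v := by
  refine ⟨⟨?_, ?_⟩, ?_, ?_⟩ <;> by_contra! hc <;> apply h
  · exact cupPairing_eq_zero_of_left fun v hv => sublevel_of_le (hc v hv)
  · rw [cupPairing_eq_weightedSum_boundary fun v hv => sublevel_of_lt (hc v hv), hx, map_zero]
  · exact cupPairing_eq_zero_of_right fun v hv => sublevel_of_le (hc v hv)
  · exact cupPairing_eq_zero_of_right fun v hv => sublevel_of_lt (hc v hv)

theorem exists_translate_cupPairing_ne_zero {σ : ι → G} {χ ψ : G → ℤ}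
    {z : κ → ι → MonoidAlgebra R G} {d : κ → MonoidAlgebra R G}
    (h : cupPairing σ χ ψ (∑ k, d k • z k) ≠ 0) :
    ∃ k, ∃ g ∈ (d k).coeff.support,
      cupPairing σ (fun v => χ (g * v)) (fun v => ψ (g * v)) (z k) ≠ 0 := by
  by_contra! hc
  apply h
  rw [map_sum]
  refine Finset.sum_eq_zero fun k _ => ?_
  have hk : d k • z k = ∑ g ∈ (d k).coeff.support,
      (MonoidAlgebra.single g ((d k).coeff g) : MonoidAlgebra R G) • z k := by
    conv_lhs => rw [← MonoidAlgebra.sum_coeff_single (d k)]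
    rw [Finsupp.sum, Finset.sum_smul]
  rw [hk, map_sum]
  exact Finset.sum_eq_zero fun g hg => by rw [cupPairing_single_smul, hc k g hg, mul_zero]

theorem exists_edge_chain (σ : ι → G) {u v : G}
    (h : (SimpleGraph.mulCayley (Set.range σ)).Adj u v) :
    ∃ e : ι → MonoidAlgebra R G,
      cayleyBoundary R σ e = MonoidAlgebra.single v 1 - MonoidAlgebra.single u 1 ∧
      size e ≤ 1 ∧ ∀ w ∈ chainVertices σ e, w = u ∨ w = v := by
  classical
  have key : ∀ (a : G) (i : ι) (r : R), ∀ w ∈ chainVertices σ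
      (Pi.single i (MonoidAlgebra.single a r) : ι → MonoidAlgebra R G), w = a ∨ w = a * σ i := by
    intro a i r w hw
    obtain ⟨j, hj⟩ := Set.mem_iUnion.1 hw
    rcases eq_or_ne j i with rfl | hji
    · rw [Pi.single_eq_same] at hj
      have hs : ∀ g ∈ (MonoidAlgebra.single a r).coeff.support, g = a := fun g hg =>
        Finset.mem_singleton.1 (Finsupp.support_single_subset hg)
      rcases hj with hj | ⟨g, hg, rfl⟩
      · exact Or.inl (hs w hj)
      · exact Or.inr (by rw [hs g hg])
    · rw [Pi.single_eq_of_ne hji] at hj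
      simp at hj
  obtain ⟨-, _, ⟨i, rfl⟩, rfl | rfl⟩ := (SimpleGraph.mulCayley_adj' _ _ _).1 h
  · refine ⟨Pi.single i (MonoidAlgebra.single u 1), ?_, ?_, key u i 1⟩
    · rw [cayleyBoundary_single, mul_sub, MonoidAlgebra.single_mul_single, mul_one, mul_one]
    · rw [size_single]
      exact card_support_single_le _ _
  · refine ⟨Pi.single i (MonoidAlgebra.single v (-1)), ?_, ?_, fun w hw => (key v i _ w hw).symm⟩
    · rw [cayleyBoundary_single, mul_sub, MonoidAlgebra.single_mul_single, mul_one, mul_one,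
        MonoidAlgebra.single_neg, MonoidAlgebra.single_neg]
      abel
    · rw [size_single]
      exact card_support_single_le _ _

theorem card_le_sq_of_forall_lt_add {P : Finset (ℕ × ℕ)} {D : ℕ}
    (h : ∀ p ∈ P, ∀ q ∈ P, q.1 < p.1 + D ∧ q.2 < p.2 + D) : P.card ≤ D ^ 2 := by
  classical
  rcases P.eq_empty_or_nonempty with rfl | hP
  · simp
  obtain ⟨p, hp, hp'⟩ := P.exists_min_image Prod.fst hP
  obtain ⟨q, hq, hq'⟩ := P.exists_min_image Prod.snd hP
  have hsub : P ⊆ Finset.Ico p.1 (p.1 + D) ×ˢ Finset.Ico q.2 (q.2 + D) := fun r hr =>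
    Finset.mem_product.2 ⟨Finset.mem_Ico.2 ⟨hp' r hr, (h p hp r hr).1⟩,
      Finset.mem_Ico.2 ⟨hq' r hr, (h q hq r hr).2⟩⟩
  refine (Finset.card_le_card hsub).trans ?_
  simp [sq]

/-- Only `D ^ 2` pairs of levels detect a given translate of a cell of diameter at most `D`, as
the distance functions are 1-Lipschitz. -/
theorem IsLinearFilling.card_levels_le {σ : ι → G} (hσ : Subgroup.closure (Set.range σ) = ⊤)
    {z : κ → ι → MonoidAlgebra R G} {K D : ℕ} (hz : IsLinearFilling σ z K)
    (hD : ∀ k, ∀ v ∈ chainVertices σ (z k), ∀ w ∈ chainVertices σ (z k),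
      (SimpleGraph.mulCayley (Set.range σ)).dist v w ≤ D)
    {γ : ι → MonoidAlgebra R G} (hγ : cayleyBoundary R σ γ = 0) (a x : G) (P : Finset (ℕ × ℕ))
    (hP : ∀ p ∈ P, cupPairing σ (sublevel ((SimpleGraph.mulCayley (Set.range σ)).dist a) p.1)
      (sublevel ((SimpleGraph.mulCayley (Set.range σ)).dist x) p.2) γ ≠ 0) :
    P.card ≤ D ^ 2 * (K * size γ) := by
  classical
  set Γ := SimpleGraph.mulCayley (Set.range σ) with hΓ
  have hconn : Γ.Connected := mulCayley_connected hσ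
  obtain ⟨d, hd, hle⟩ := hz.exists_filling γ hγ
  have hcell : ∀ p ∈ P, ∃ c : Σ _ : κ, G, c.2 ∈ (d c.1).coeff.support ∧
      cupPairing σ (sublevel (fun v => Γ.dist a (c.2 * v)) p.1)
        (sublevel (fun v => Γ.dist x (c.2 * v)) p.2) (z c.1) ≠ 0 := by
    intro p hp
    have := hP p hp
    rw [hd] at this
    obtain ⟨k, g, hg, hne⟩ := exists_translate_cupPairing_ne_zero this
    exact ⟨⟨k, g⟩, hg, hne⟩
  rcases P.eq_empty_or_nonempty with rfl | ⟨p₀, hp₀⟩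
  · simp
  have : Nonempty (Σ _ : κ, G) := ⟨(hcell p₀ hp₀).choose⟩
  choose! c hc hne using hcell
  -- the values of a distance function at two vertices of a translated cell differ by at most `D`
  have hlip : ∀ (b g : G) (k : κ), ∀ v ∈ chainVertices σ (z k), ∀ w ∈ chainVertices σ (z k),
      Γ.dist b (g * w) ≤ Γ.dist b (g * v) + D := by
    intro b g k v hv w hw
    have h1 := hconn.dist_triangle (u := b) (v := g * v) (w := g * w)
    have h2 := (dist_mulCayley_mul_left_le hσ g v w).trans (hD k v hv w hw)
    rw [← hΓ] at h2
    omega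
  have hfiber : ∀ b ∈ Finset.univ.sigma fun k => (d k).coeff.support,
      (P.filter fun p => c p = b).card ≤ D ^ 2 := by
    rintro ⟨k, g⟩ -
    refine card_le_sq_of_forall_lt_add fun p hp q hq => ?_
    obtain ⟨hp, hpc⟩ := Finset.mem_filter.1 hp
    obtain ⟨hq, hqc⟩ := Finset.mem_filter.1 hq
    have hp' := hne p hp
    have hq' := hne q hq
    rw [hpc] at hp'
    rw [hqc] at hq'
    obtain ⟨⟨⟨v₁, hv₁, hv₁'⟩, -⟩, ⟨v₂, hv₂, hv₂'⟩, -⟩ :=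
      exists_crossing_of_cupPairing_ne_zero (hz.boundary_eq_zero k) hp'
    obtain ⟨⟨-, w₁, hw₁, hw₁'⟩, -, w₂, hw₂, hw₂'⟩ :=
      exists_crossing_of_cupPairing_ne_zero (hz.boundary_eq_zero k) hq'
    have h1 := hlip a g k v₁ hv₁ w₁ hw₁
    have h2 := hlip x g k v₂ hv₂ w₂ hw₂
    dsimp only at hv₁' hv₂' hw₁' hw₂'
    omega
  have hcard := Finset.card_le_mul_card_image_of_maps_to
    (fun p hp => Finset.mem_sigma.2 ⟨Finset.mem_univ _, hc p hp⟩) (D ^ 2) hfiber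
  rw [Finset.card_sigma] at hcard
  exact hcard.trans (Nat.mul_le_mul_left _ hle)

/-- The chain of a closed walk, which follows a geodesic from `x` through `a` and then stays
outside the ball of radius `L` about `a`, is detected by each pair of levels `t` of `d(a, ·)` and
`j` of `d(x, ·)` which the geodesic meets close enough to `a`. -/
theorem quadraticDetours_of_isLinearFilling [Nontrivial R] {σ : ι → G}
    (hσ : Subgroup.closure (Set.range σ) = ⊤) {z : κ → ι → MonoidAlgebra R G} {K D : ℕ}
    (hz : IsLinearFilling σ z K)
    (hD : ∀ k, ∀ v ∈ chainVertices σ (z k), ∀ w ∈ chainVertices σ (z k),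
      (SimpleGraph.mulCayley (Set.range σ)).dist v w ≤ D) :
    QuadraticDetours (SimpleGraph.mulCayley (Set.range σ)) (D ^ 2 * K) := by
  classical
  set Γ := SimpleGraph.mulCayley (Set.range σ) with hΓ
  have hconn : Γ.Connected := mulCayley_connected hσ
  intro x y a w L hbetween hfar
  obtain ⟨p₁, hp₁⟩ := hconn.exists_walk_length_eq_dist x a
  obtain ⟨p₂, hp₂⟩ := hconn.exists_walk_length_eq_dist a y
  obtain ⟨p, hp, m, hm, rfl⟩ : ∃ p : Γ.Walk x y, IsGeodesic p ∧ ∃ m ≤ p.length,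
      p.getVert m = a := by
    refine ⟨p₁.append p₂, ?_, p₁.length, ?_, ?_⟩
    · rw [IsGeodesic, SimpleGraph.Walk.length_append]
      omega
    · rw [SimpleGraph.Walk.length_append]
      omega
    · simp [SimpleGraph.Walk.getVert_append]
  have hpx : ∀ i ≤ p.length, Γ.dist x (p.getVert i) = i := fun i hi => by
    have := hp.dist_getVert hconn (Nat.zero_le i) hi
    rwa [SimpleGraph.Walk.getVert_zero] at this
  have hmL : m + L ≤ p.length := by
    have h1 := hp.dist_getVert hconn hm le_rfl
    rw [SimpleGraph.Walk.getVert_length] at h1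
    have h2 := hfar y w.start_mem_support
    omega
  set W := p.append w with hW
  have hWlen : W.length = p.length + w.length := SimpleGraph.Walk.length_append _ _
  have hWp : ∀ i ≤ p.length, W.getVert i = p.getVert i := fun i hi => by
    rw [hW, SimpleGraph.Walk.getVert_append', if_pos hi]
  have hWw : ∀ i, p.length ≤ i → W.getVert i ∈ w.support := fun i hi => by
    rw [hW, SimpleGraph.Walk.getVert_append, if_neg hi.not_gt]
    exact w.getVert_mem_support _
  have hedge : ∀ i, ∃ e : ι → MonoidAlgebra R G, i < W.length →
      cayleyBoundary R σ e =
        MonoidAlgebra.single (W.getVert (i + 1)) 1 - MonoidAlgebra.single (W.getVert i) 1 ∧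
      size e ≤ 1 ∧ ∀ v ∈ chainVertices σ e, v = W.getVert i ∨ v = W.getVert (i + 1) := by
    intro i
    by_cases hi : i < W.length
    · obtain ⟨e, he⟩ := exists_edge_chain (R := R) σ (W.adj_getVert_succ hi)
      exact ⟨e, fun _ => he⟩
    · exact ⟨0, fun h => absurd h hi⟩
  choose e he using hedge
  set γ := ∑ i ∈ Finset.range W.length, e i with hγdef
  have hγ : cayleyBoundary R σ γ = 0 := by
    rw [hγdef, map_sum, Finset.sum_congr rfl fun i hi => (he i (Finset.mem_range.1 hi)).1,
      Finset.sum_range_sub (fun i => (MonoidAlgebra.single (W.getVert i) 1 : MonoidAlgebra R G)),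
      SimpleGraph.Walk.getVert_length, SimpleGraph.Walk.getVert_zero, sub_self]
  have hsize : size γ ≤ W.length := by
    refine (size_sum_le _ _).trans ((Finset.sum_le_card_nsmul _ _ 1 fun i hi => ?_).trans ?_)
    · exact (he i (Finset.mem_range.1 hi)).2.1
    · simp
  -- the levels `t` in `(L / 2, L]` and `j` in `(m, m + L / 2]`
  have hpair : ∀ q ∈ Finset.Ico (L / 2 + 1) (L / 2 + 1 + L / 2) ×ˢ
      Finset.Ico (m + 1) (m + 1 + L / 2),
      cupPairing σ (sublevel (Γ.dist (p.getVert m)) q.1) (sublevel (Γ.dist x) q.2) γ ≠ 0 := by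
    rintro ⟨t, j⟩ hq
    obtain ⟨ht, hj⟩ := Finset.mem_product.1 hq
    rw [Finset.mem_Ico] at ht hj
    dsimp only at ht hj ⊢
    rw [hγdef, map_sum, Finset.sum_eq_single (j - 1)]
    · obtain ⟨hbd, -, hvert⟩ := he (j - 1) (by omega)
      have h1 : ∀ v ∈ chainVertices σ (e (j - 1)), sublevel (Γ.dist (p.getVert m)) t v = 1 := by
        intro v hv
        refine sublevel_of_lt ?_
        rcases hvert v hv with rfl | rfl
        · rw [hWp _ (by omega), hp.dist_getVert hconn (by omega) (by omega)]
          omega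
        · rw [hWp _ (by omega), hp.dist_getVert hconn (by omega) (by omega)]
          omega
      rw [cupPairing_eq_weightedSum_boundary h1, hbd, map_sub, weightedSum_single,
        weightedSum_single, hWp _ (by omega), hWp _ (by omega), sublevel, sublevel,
        hpx _ (by omega), hpx _ (by omega), if_neg (by omega), if_pos (by omega)]
      simp
    · intro i hi hij
      have hi' := Finset.mem_range.1 hi
      obtain ⟨-, -, hvert⟩ := he i hi'
      rcases lt_or_ge i p.length with hip | hip
      · -- both ends of the edge lie on the same side of the level `j`
        refine cupPairing_eq_zero_of_right (n := if i < j then 1 else 0) fun v hv => ?_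
        rw [sublevel]
        rcases hvert v hv with rfl | rfl
        · rw [hWp _ (by omega), hpx _ (by omega)]
        · rw [hWp _ (by omega), hpx _ (by omega)]
          exact if_congr (by omega) rfl rfl
      · refine cupPairing_eq_zero_of_left fun v hv => sublevel_of_le ?_
        rcases hvert v hv with rfl | rfl
        · have := hfar _ (hWw i hip)
          omega
        · have := hfar _ (hWw (i + 1) (by omega))
          omega
    · intro hnot
      exact absurd (Finset.mem_range.2 (by omega)) hnot
  have hcard := hz.card_levels_le hσ hD hγ _ _ _ hpair
  rw [Finset.card_product, Nat.card_Ico, Nat.card_Ico, Nat.add_sub_cancel_left,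
    Nat.add_sub_cancel_left, ← sq] at hcard
  refine hcard.trans ?_
  rw [← mul_assoc]
  refine Nat.mul_le_mul_left _ (hsize.trans ?_)
  unfold IsGeodesic at hp
  omega

theorem exists_dist_le_of_mem_chainVertices (Γ : SimpleGraph G) (σ : ι → G)
    (z : κ → ι → MonoidAlgebra R G) :
    ∃ D, ∀ k, ∀ v ∈ chainVertices σ (z k), ∀ w ∈ chainVertices σ (z k), Γ.dist v w ≤ D := by
  have hfin : (⋃ k, (fun q : G × G => Γ.dist q.1 q.2) ''
      (chainVertices σ (z k) ×ˢ chainVertices σ (z k))).Finite :=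
    Set.finite_iUnion fun k =>
      ((finite_chainVertices σ (z k)).prod (finite_chainVertices σ (z k))).image _
  obtain ⟨D, hD⟩ := hfin.bddAbove
  exact ⟨D, fun k v hv w hw => hD (Set.mem_iUnion.2 ⟨k, (v, w), ⟨hv, hw⟩, rfl⟩)⟩

end Pairing

end HomologicalFilling

end

theorem proposition4p1 {R : Type u} {G : Type v} [Ring R] [Nontrivial R] [Group G]
    (hFP : HomologicalFilling.IsTypeFP R G 2)
    (hlin : HomologicalFilling.SatisfiesLinearIsoperimetric R G 1) :
    HomologicalFilling.IsHyperbolicGroup G := by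
  obtain ⟨C, A, hA⟩ := hlin
  refine ⟨HomologicalFilling.group_fg_of_resolution C A.basis, fun S hS hgen => ?_⟩
  have := hS.fintype
  have hrange : Set.range ((↑) : S → G) = S := Subtype.range_coe
  obtain ⟨z, K, hz⟩ := HomologicalFilling.exists_isLinearFilling hA ((↑) : S → G)
    (hrange.symm ▸ hgen)
  obtain ⟨D, hD⟩ := HomologicalFilling.exists_dist_le_of_mem_chainVertices
    (SimpleGraph.mulCayley (Set.range ((↑) : S → G))) _ z
  have hquad := HomologicalFilling.quadraticDetours_of_isLinearFilling (hrange.symm ▸ hgen) hz hD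
  rw [hrange] at hquad
  exact hquad.isHyperbolicGraph (HomologicalFilling.mulCayley_connected hgen)
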